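/- Let $\mathbb N$ be the set of natural numbers, $[\mathbb N]^\infty$ the family of infinite subsets of $\mathbb N$, and $\mathrm{Fin}$ the family of finite subsets of $\mathbb N$. The family $P(\mathbb N)$ of all subsets of $\mathbb N$ is identified with the Cantor space $\{0,1\}^{\mathbb N}$ via characteristic functions, and subsets of $P(\mathbb N)$ carry the subspace topology. An element $a\in[\mathbb N]^\infty$ is identified with its increasing enumeration $a\colon\mathbb N\to\mathbb N$. A set of reals is a topological space homeomorphic to a subset of the real line. A cover of a space is a family of proper subsets of the space whose union is the entire space. An $\omega$-cover of a space is a cover by open sets such that each finite subset of the space is contained in a member of the cover. A $\gamma$-cover is an infinite cover such that each point of the space belongs to all but finitely many members of the cover. A space satisfies $\binom{\Omega}{\Gamma}$ (the Gerlits--Nagy property $\gamma$) if every $\omega$-cover of the space contains a $\gamma$-cover of the space. A set of reals is productively $\binom{\Omega}{\Gamma}$ if its product with every set of reals satisfying $\binom{\Omega}{\Gamma}$ satisfies $\binom{\Omega}{\Gamma}$. Let $\mathfrak p$ be the minimal cardinality of a family $\mathcal F\subseteq[\mathbb N]^\infty$ such that all intersections of finitely many elements of $\mathcal F$ are infinite,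 but there is no $a\in[\mathbb N]^\infty$ with $a\setminus b$ finite for all $b\in\mathcal F$. A $\mathfrak p$-generalized tower is a set $X\subseteq[\mathbb N]^\infty$ with $|X|\ge\mathfrak p$ such that for each $a\in[\mathbb N]^\infty$ there are $b\in[\mathbb N]^\infty$ and $S\subseteq X$ with $|S|<\mathfrak p$ such that the set $x\cap\bigcup_{n\in b}[a(n),a(n+1))$ is finite for all $x\in X\setminus S$. A $\mathfrak p$-generalized tower set is a set of the form $X\cup\mathrm{Fin}\subseteq P(\mathbb N)$, where $X$ is a $\mathfrak p$-generalized tower. **Theorem.** (1) The product space of finitely many $\mathfrak p$-generalized tower sets satisfies $\binom{\Omega}{\Gamma}$. (2) Assume that there is a $\mathfrak p$-generalized tower. Then the following assertions are equivalent: (a) Each set of reals of cardinality smaller than $\mathfrak p$ is productively $\binom{\Omega}{\Gamma}$. (b) Each $\mathfrak p$-generalized tower set is productively $\binom{\Omega}{\Gamma}$. -/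

import Mathlib

open Cardinal

namespace GammaTower

/-! ### Covers and the Gerlits-Nagy property -/

/-- A cover of a space: a family of proper subsets whose union is the whole space. -/
def IsCover {X : Type*} (𝒰 : Set (Set X)) : Prop :=
  (∀ U ∈ 𝒰, U ≠ Set.univ) ∧ ⋃₀ 𝒰 = Set.univ

/-- An ω-cover: an open cover such that each finite subset of the space is contained in
a member of the cover. -/
def IsOmegaCover {X : Type*} [TopologicalSpace X] (𝒰 : Set (Set X)) : Prop :=
  IsCover 𝒰 ∧ (∀ U ∈ 𝒰, IsOpen U) ∧ ∀ F : Set X, F.Finite → ∃ U ∈ 𝒰, F ⊆ U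

/-- A γ-cover: an infinite cover such that each point belongs to all but finitely many members. -/
def IsGammaCover {X : Type*} (𝒰 : Set (Set X)) : Prop :=
  𝒰.Infinite ∧ IsCover 𝒰 ∧ ∀ x : X, {U ∈ 𝒰 | x ∉ U}.Finite

/-- Property γ: every ω-cover of the space contains a γ-cover of the space. -/
def HasGamma (X : Type*) [TopologicalSpace X] : Prop :=
  ∀ 𝒰 : Set (Set X), IsOmegaCover 𝒰 → ∃ 𝒱 : Set (Set X), 𝒱 ⊆ 𝒰 ∧ IsGammaCover 𝒱

/-- A set of reals: a space homeomorphic to a subset of the real line. -/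
def IsSetOfReals (X : Type*) [TopologicalSpace X] : Prop :=
  ∃ A : Set ℝ, Nonempty (X ≃ₜ A)

/-- Productively γ: the product with each set of reals that has property γ has property γ. -/
def ProductivelyGamma (X : Type*) [TopologicalSpace X] : Prop :=
  ∀ (Y : Type) [TopologicalSpace Y], IsSetOfReals Y → HasGamma Y → HasGamma (X × Y)

/-! ### The pseudointersection number -/

/-- A centered family of sets of natural numbers: finite intersections of its elements
are infinite. -/
def IsCentered (𝓕 : Set (Set ℕ)) : Prop :=
  ∀ 𝓖 : Set (Set ℕ), 𝓖 ⊆ 𝓕 → 𝓖.Finite → (⋂₀ 𝓖).Infinite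

/-- A pseudointersection of a family: an infinite set that is almost contained in each member. -/
def IsPseudointersection (a : Set ℕ) (𝓕 : Set (Set ℕ)) : Prop :=
  a.Infinite ∧ ∀ b ∈ 𝓕, (a \ b).Finite

/-- The cardinal `𝔭`: the minimal cardinality of a centered family of infinite sets of natural
numbers that has no pseudointersection. -/
noncomputable def cardP : Cardinal.{0} :=
  sInf {κ | ∃ 𝓕 : Set (Set ℕ), (∀ b ∈ 𝓕, b.Infinite) ∧ IsCentered 𝓕 ∧
    (¬ ∃ a, IsPseudointersection a 𝓕) ∧ #𝓕 = κ}

/-- Such families exist, so that the minimum in `cardP` is attained. -/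
theorem exists_centered_no_pseudointersection :
    ∃ 𝓕 : Set (Set ℕ), (∀ b ∈ 𝓕, b.Infinite) ∧ IsCentered 𝓕 ∧
      (¬ ∃ a, IsPseudointersection a 𝓕) ∧ #𝓕 = cardP := by
  have hne : {κ : Cardinal.{0} | ∃ 𝓕 : Set (Set ℕ), (∀ b ∈ 𝓕, b.Infinite) ∧ IsCentered 𝓕 ∧
      (¬ ∃ a, IsPseudointersection a 𝓕) ∧ #𝓕 = κ}.Nonempty := by
    have hinf : ∀ b ∈ Filter.hyperfilter ℕ, b.Infinite := fun b hb hf =>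
      Set.Finite.notMem_hyperfilter hf hb
    refine ⟨_, {b | b ∈ Filter.hyperfilter ℕ}, hinf, ?_, ?_, rfl⟩
    · intro 𝓖 h𝓖 hfin
      exact hinf _ ((Filter.sInter_mem hfin).2 h𝓖)
    · rintro ⟨a, ha, hab⟩
      have hn : ∀ k, Nat.nth (· ∈ a) k ∈ a := fun k => Nat.nth_mem_of_infinite ha k
      have hinj := Nat.nth_injective (p := (· ∈ a)) ha
      have hE : (Set.range fun k => Nat.nth (· ∈ a) (2 * k)).Infinite :=
        Set.infinite_range_of_injective fun i j h => by
          have := hinj h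
          omega
      have hO : (Set.range fun k => Nat.nth (· ∈ a) (2 * k + 1)).Infinite :=
        Set.infinite_range_of_injective fun i j h => by
          have := hinj h
          omega
      rcases Ultrafilter.mem_or_compl_mem (Filter.hyperfilter ℕ)
        (Set.range fun k => Nat.nth (· ∈ a) (2 * k)) with h | h
      · refine hO ((hab _ h).subset ?_)
        rintro _ ⟨k, rfl⟩
        refine ⟨hn _, ?_⟩
        rintro ⟨j, hj⟩
        have := hinj hj
        omega
      · refine hE ((hab _ h).subset ?_)
        rintro _ ⟨k, rfl⟩
        exact ⟨hn _, fun hc => hc ⟨k, rfl⟩⟩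
  exact csInf_mem hne

/-! ### Generalized towers -/

/-- A `κ`-generalized tower: a family `X` of infinite sets of natural numbers with at least `κ`
members such that for each `a` in `[ℕ]^∞`, viewed as a strictly increasing function, there are an
infinite set `b` and a set `S ⊆ X` with fewer than `κ` members such that each `x ∈ X \ S` has a
finite intersection with the union of the intervals `[a(n), a(n+1))`, `n ∈ b`. -/
def IsGeneralizedTower (κ : Cardinal.{0}) (X : Set (Set ℕ)) : Prop :=
  (∀ x ∈ X, x.Infinite) ∧ κ ≤ #X ∧
    ∀ a : ℕ → ℕ, StrictMono a →
      ∃ (b : Set ℕ) (S : Set (Set ℕ)), b.Infinite ∧ S ⊆ X ∧ #S < κ ∧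
        ∀ x ∈ X \ S, (x ∩ ⋃ n ∈ b, Set.Ico (a n) (a (n + 1))).Finite

/-- A `κ`-generalized tower set: a set `X ∪ Fin`, where `X` is a `κ`-generalized tower and `Fin`
is the family of finite sets of natural numbers. It is a subset of the Cantor space `ℕ → Bool`,
whose points are identified with sets of natural numbers via characteristic functions. -/
def IsGeneralizedTowerSet (κ : Cardinal.{0}) (Z : Set (ℕ → Bool)) : Prop :=
  ∃ X : Set (Set ℕ), IsGeneralizedTower κ X ∧
    Z = {χ | {n | χ n = true} ∈ X ∪ {s : Set ℕ | s.Finite}}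

end GammaTower

namespace GammaTower

open Filter Topology

/-! ### Combinatorics of the pseudointersection number -/

/-! Property γ is handled in the sequential form `GammaSeq`, which it always implies and which is
equivalent to it for second countable spaces.

The core is `gammaSeq_towerLike_prod`: if `S × Y` has γ for all `S` with fewer than `𝔭` points, then
so does `Z × Y` for each tower set `Z`. If an open set contains `(s, y)` for all `s ⊆ [0, k)`, then
for large `l` it contains `(x, y)` for every `x` missing `[k, l)`. The tower property makes all but
fewer than `𝔭` points of `Z` miss infinitely many prescribed intervals, and the exceptional points
are left to the hypothesis on `S × Y`. Since the exceptional set depends on the intervals, the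
construction is iterated `ω` times and then diagonalized; the exceptional sets accumulated stay
small by `mk_iUnion_lt_cardP`.

The hypothesis on `Y` is inherited by `Z × Y`, so induction gives (1), and the same lemma gives (a)
⇒ (b). For (b) ⇒ (a), a small set of reals embeds in the Cantor space, hence in the closed set of
codes `doubleCode x`. A tower contains fewer than `𝔭` codes; replacing these by the copy of the
small set gives a tower set with that copy as a closed subspace
(`exists_towerSet_isClosedEmbedding`), and γ passes to closed subspaces. -/

theorem exists_isPseudointersection {𝓕 : Set (Set ℕ)} (hinf : ∀ b ∈ 𝓕, b.Infinite)
    (hc : IsCentered 𝓕) (h𝓕 : #𝓕 < cardP) : ∃ a, IsPseudointersection a 𝓕 := by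
  by_contra h
  exact notMem_of_lt_csInf h𝓕 (OrderBot.bddBelow _) ⟨𝓕, hinf, hc, h, rfl⟩

theorem exists_strictMono_eventually_mem {T : Type} (hT : #T < cardP) (A : T → Set ℕ)
    (hA : ∀ F : Set T, F.Finite → ∃ᶠ n in atTop, ∀ t ∈ F, n ∈ A t) :
    ∃ φ : ℕ → ℕ, StrictMono φ ∧ ∀ t, ∀ᶠ n in atTop, φ n ∈ A t := by
  obtain ⟨a, ha, hab⟩ := exists_isPseudointersection (𝓕 := Set.range A)
    (by
      rintro _ ⟨t, rfl⟩
      refine Nat.frequently_atTop_iff_infinite.1 ?_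
      exact (hA {t} (Set.finite_singleton t)).mono fun n hn => hn t rfl)
    (by
      intro 𝓖 h𝓖 hfin
      rw [← Set.image_univ] at h𝓖
      obtain ⟨F, -, hFbij⟩ := Set.SurjOn.exists_bijOn_subset h𝓖
      have hF : F.Finite := hFbij.finite_iff_finite.2 hfin
      rw [← hFbij.image_eq]
      refine Nat.frequently_atTop_iff_infinite.1 ((hA F hF).mono fun n hn => ?_)
      rintro _ ⟨t, ht, rfl⟩
      exact hn t ht)
    (mk_range_le.trans_lt hT)
  refine ⟨Nat.nth (· ∈ a), Nat.nth_strictMono ha, fun t => ?_⟩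
  obtain ⟨M, hM⟩ := (hab _ ⟨t, rfl⟩).bddAbove
  filter_upwards [eventually_gt_atTop M] with n hn
  by_contra h
  have h1 := hM ⟨Nat.nth_mem_of_infinite ha n, h⟩
  exact absurd (hn.trans_le ((Nat.nth_strictMono ha).le_apply.trans h1)) (lt_irrefl _)

theorem aleph0_lt_cardP : ℵ₀ < cardP := by
  obtain ⟨𝓕, hinf, hc, hp, hcard⟩ := exists_centered_no_pseudointersection
  by_contra! h
  refine hp ?_
  rw [← hcard, Cardinal.le_aleph0_iff_set_countable] at h
  rcases 𝓕.eq_empty_or_nonempty with rfl | hne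
  · exact ⟨Set.univ, Set.infinite_univ, by simp⟩
  obtain ⟨f, rfl⟩ := h.exists_eq_range hne
  obtain ⟨φ, hφ, hφf⟩ := extraction_forall_of_frequently (P := fun n k => ∀ i ≤ n, k ∈ f i)
    (fun n => by
      have := hc (f '' Set.Iic n) (Set.image_subset_range _ _) ((Set.finite_Iic n).image f)
      refine (Nat.frequently_atTop_iff_infinite.2 this).mono fun k hk i hi => ?_
      exact hk _ ⟨i, hi, rfl⟩)
  refine ⟨Set.range φ, Set.infinite_range_of_injective hφ.injective, ?_⟩
  rintro _ ⟨i, rfl⟩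
  refine ((Set.finite_lt_nat i).image φ).subset ?_
  rintro _ ⟨⟨n, rfl⟩, hn⟩
  exact ⟨n, not_le.1 fun h => hn (hφf n i h), rfl⟩

/-- This is `𝔭 ≤ 𝔟`. On `ℕ × ℕ`, the regions above the graphs and the regions to the right of each
column form a centered family. A region asks `m` to bound `g t` on all of `[0, k]`, so a point `(k,
m)` with `k ≥ n` can serve as the bound at `n`. -/
theorem exists_eventually_le {T : Type} (hT : #T < cardP) (g : T → ℕ → ℕ) :
    ∃ h : ℕ → ℕ, ∀ t, ∀ᶠ n in atTop, g t n ≤ h n := by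
  have e : ℕ ≃ ℕ × ℕ := (Denumerable.eqv (ℕ × ℕ)).symm
  have hT' : #(T ⊕ ℕ) < cardP := by
    rw [mk_sum]
    simpa using add_lt_of_lt aleph0_lt_cardP.le hT aleph0_lt_cardP
  let A : T ⊕ ℕ → Set ℕ := Sum.elim (fun t => {r | ∀ i ≤ (e r).1, g t i ≤ (e r).2})
    (fun n => {r | n ≤ (e r).1})
  obtain ⟨φ, hφ, hφA⟩ := exists_strictMono_eventually_mem hT' A (by
    intro F hF
    rw [Nat.frequently_atTop_iff_infinite]
    have h1 : ∀ k : ℕ, ∀ᶠ m in atTop, ∀ t ∈ F, ∀ t', t = Sum.inl t' → ∀ i ≤ k, g t' i ≤ m := by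
      intro k
      refine (eventually_all_finite hF).2 fun t _ => ?_
      rcases t with t | n
      · have : ∀ᶠ m in atTop, ∀ i ∈ Set.Iic k, g t i ≤ m :=
          (eventually_all_finite (Set.finite_Iic k)).2 fun i _ => eventually_ge_atTop _
        filter_upwards [this] with m hm t' ht' i hi
        cases ht'
        exact hm i hi
      · simp
    have h2 : ∀ᶠ k in atTop, ∀ t ∈ F, ∀ n, t = Sum.inr n → n ≤ k := by
      refine (eventually_all_finite hF).2 fun t _ => ?_
      rcases t with t | n
      · simp
      · filter_upwards [eventually_ge_atTop n] with m hm n' hn'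
        cases hn'
        exact hm
    obtain ⟨k, hk⟩ := h2.exists
    refine Set.Infinite.mono (s := e.symm '' ((fun m => (k, m)) ''
      {m | ∀ t ∈ F, ∀ t', t = Sum.inl t' → ∀ i ≤ k, g t' i ≤ m})) ?_ ?_
    · rintro _ ⟨_, ⟨m, hm, rfl⟩, rfl⟩ t ht
      rcases t with t | n
      · simpa [A] using hm _ ht t rfl
      · simpa [A] using hk _ ht n rfl
    · refine (Set.Infinite.image (fun _ _ _ _ h => (Prod.ext_iff.1 h).2) ?_).image
        e.symm.injective.injOn
      exact Nat.frequently_atTop_iff_infinite.1 (h1 k).frequently)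
  have h3 : ∀ n, ∃ᶠ r in atTop, n ≤ (e (φ r)).1 := fun n => (hφA (Sum.inr n)).frequently
  obtain ⟨ψ, hψ, hψn⟩ := extraction_forall_of_frequently h3
  refine ⟨fun n => (e (φ (ψ n))).2, fun t => ?_⟩
  filter_upwards [hψ.tendsto_atTop.eventually (hφA (Sum.inl t))] with n hn
  exact hn n (hψn n)

theorem cardP_le_continuum : cardP ≤ 𝔠 := by
  obtain ⟨𝓕, -, -, -, hcard⟩ := exists_centered_no_pseudointersection
  rw [← hcard]
  exact (mk_set_le 𝓕).trans (by simp)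

/-- Otherwise a family witnessing `𝔭` would be an increasing union of smaller families `𝓕' i`, each
with a pseudointersection `A i`. Choosing the `n`-th point in `A n`, beyond functions that dominate
the moduli of almost inclusion, would give a pseudointersection of the whole family. -/
theorem mk_iUnion_lt_cardP {α : Type} {S : ℕ → Set α} (hS : Monotone S)
    (hlt : ∀ i, #(S i) < cardP) : #(⋃ i, S i) < cardP := by
  by_contra! hle
  obtain ⟨𝓕, hinf, hc, hp, hcard⟩ := exists_centered_no_pseudointersection
  rw [← hcard] at hle
  obtain ⟨f⟩ := hle
  let 𝓕' : ℕ → Set (Set ℕ) := fun i => {b | ∃ hb : b ∈ 𝓕, (f ⟨b, hb⟩ : α) ∈ S i}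
  have hsub : ∀ i, 𝓕' i ⊆ 𝓕 := fun i b hb => hb.1
  have hlt' : ∀ i, #(𝓕' i) < cardP := fun i => by
    refine lt_of_le_of_lt ?_ (hlt i)
    refine mk_le_of_injective (f := fun b : 𝓕' i => (⟨f ⟨b, b.2.1⟩, b.2.2⟩ : S i)) ?_
    intro b b' h
    simp only [Subtype.mk.injEq] at h
    have := f.injective (Subtype.ext h)
    exact Subtype.ext (by simpa using this)
  have hA : ∀ i, ∃ a, IsPseudointersection a (𝓕' i) := fun i =>
    exists_isPseudointersection (fun b hb => hinf b (hsub i hb))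
      (fun 𝓖 h𝓖 => hc 𝓖 (h𝓖.trans (hsub i))) (hlt' i)
  choose A hAinf hA using hA
  have hg : ∀ (b : Set ℕ) (i : ℕ), ∃ N, (A i \ b).Finite → ∀ m ∈ A i, N ≤ m → m ∈ b := by
    intro b i
    by_cases hfin : (A i \ b).Finite
    · obtain ⟨M, hM⟩ := hfin.bddAbove
      refine ⟨M + 1, fun _ m hm hMm => ?_⟩
      by_contra h
      have := hM ⟨hm, h⟩
      omega
    · exact ⟨0, fun h => absurd h hfin⟩
  choose g hg using hg
  have hh := fun i => exists_eventually_le (hlt' i) (fun b => g b)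
  choose h hh using hh
  obtain ⟨φ, hφ, hφA⟩ := extraction_forall_of_frequently
    (P := fun n m => m ∈ A n ∧ ∀ i ≤ n, h i n ≤ m) (fun n => by
      refine (Nat.frequently_atTop_iff_infinite.2 (hAinf n)).and_eventually ?_
      exact (eventually_all_finite (Set.finite_Iic n)).2 fun i _ => eventually_ge_atTop _)
  refine hp ⟨Set.range φ, Set.infinite_range_of_injective hφ.injective, fun b hb => ?_⟩
  obtain ⟨n, hn⟩ := Set.mem_iUnion.1 (f ⟨b, hb⟩).2
  have hbi : ∀ i, n ≤ i → b ∈ 𝓕' i := fun i hi => ⟨hb, hS hi hn⟩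
  obtain ⟨N, hN⟩ := eventually_atTop.1 (hh n ⟨b, hbi n le_rfl⟩)
  refine ((Set.finite_lt_nat (max n N)).image φ).subset ?_
  rintro _ ⟨⟨i, rfl⟩, hi⟩
  refine ⟨i, (not_le.1 fun hle => hi ?_ : i < max n N), rfl⟩
  have hni := (le_max_left n N).trans hle
  exact hg b i (hA i b (hbi i hni)) _ (hφA i).1
    ((hN i ((le_max_right n N).trans hle)).trans ((hφA i).2 n hni))

/-! ### A sequential form of property γ -/

/-- The sequential form of property γ: each sequence of open sets such that every finite set is
contained in infinitely many of its terms has a subsequence that converges to the whole space. -/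
def GammaSeq (X : Type*) [TopologicalSpace X] : Prop :=
  ∀ U : ℕ → Set X, (∀ n, IsOpen (U n)) →
    (∀ F : Set X, F.Finite → ∃ᶠ n in atTop, F ⊆ U n) →
    ∃ φ : ℕ → ℕ, StrictMono φ ∧ ∀ x, ∀ᶠ n in atTop, x ∈ U (φ n)

theorem HasGamma.gammaSeq {X : Type*} [TopologicalSpace X] (h : HasGamma X) : GammaSeq X := by
  intro U hU hF
  by_cases hinf : {n | U n = Set.univ}.Infinite
  · refine ⟨Nat.nth (· ∈ {n | U n = Set.univ}), Nat.nth_strictMono hinf, fun x => .of_forall ?_⟩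
    intro n
    have h1 : U _ = Set.univ := Nat.nth_mem_of_infinite (p := (· ∈ {n | U n = Set.univ})) hinf n
    rw [h1]
    trivial
  have hne : ∀ᶠ n in atTop, U n ≠ Set.univ := by
    rw [← Nat.cofinite_eq_atTop]
    simpa [Filter.eventually_cofinite] using hinf
  have hfin : ∀ F : Set X, F.Finite → ∃ V ∈ {V | V ≠ Set.univ ∧ ∃ n, U n = V}, F ⊆ V := by
    intro F hFf
    obtain ⟨n, hn, hn'⟩ := ((hF F hFf).and_eventually hne).exists
    exact ⟨U n, ⟨hn', n, rfl⟩, hn⟩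
  obtain ⟨𝒱, h𝒱, hinf𝒱, -, hx𝒱⟩ := h {V | V ≠ Set.univ ∧ ∃ n, U n = V} ⟨⟨fun V hV => hV.1, by
    refine Set.eq_univ_of_forall fun x => ?_
    obtain ⟨V, hV, hxV⟩ := hfin {x} (Set.finite_singleton x)
    exact ⟨V, hV, hxV rfl⟩⟩, by
    rintro V ⟨-, n, rfl⟩
    exact hU n, hfin⟩
  have : Infinite 𝒱 := hinf𝒱.to_subtype
  let e := Infinite.natEmbedding 𝒱
  have hr : ∀ k, ∃ n, U n = e k := fun k => (h𝒱 (e k).2).2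
  choose r hr using hr
  have hrinj : Function.Injective r := fun i j hij =>
    e.injective (Subtype.ext (by rw [← hr, ← hr, hij]))
  obtain ⟨ψ, hψ, hrψ⟩ := strictMono_subseq_of_tendsto_atTop hrinj.nat_tendsto_atTop
  refine ⟨r ∘ ψ, hrψ, fun x => hψ.tendsto_atTop.eventually (p := fun n => x ∈ U (r n)) ?_⟩
  rw [← Nat.cofinite_eq_atTop, Filter.eventually_cofinite]
  have := (hx𝒱 x).preimage (f := fun k => (e k : Set X))
    (fun i _ j _ hij => e.injective (Subtype.ext hij))
  refine this.subset fun k hk => ⟨(e k).2, fun hm => hk ?_⟩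
  rw [hr]
  exact hm

/-- One member is chosen above each finite union of basic open sets that lies in some member; there
are countably many such unions. -/
theorem IsOmegaCover.exists_countable_subset {X : Type*} [TopologicalSpace X]
    [SecondCountableTopology X] {𝒰 : Set (Set X)} (h : IsOmegaCover 𝒰) :
    ∃ 𝒱 ⊆ 𝒰, 𝒱.Countable ∧ ∀ F : Set X, F.Finite → ∃ U ∈ 𝒱, F ⊆ U := by
  let B := TopologicalSpace.countableBasis X
  let C : Set (Set (Set X)) := {s | (s.Finite ∧ s ⊆ B) ∧ ∃ U ∈ 𝒰, ⋃₀ s ⊆ U}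
  have hC : C.Countable :=
    (Set.countable_ofPred_finite_subset (TopologicalSpace.countable_countableBasis X)).mono
      fun s hs => hs.1
  have hu : ∀ s : C, ∃ U ∈ 𝒰, ⋃₀ s.1 ⊆ U := fun s => s.2.2
  choose u hu𝒰 hsu using hu
  have := hC.to_subtype
  refine ⟨Set.range u, Set.range_subset_iff.2 hu𝒰, Set.countable_range u, fun F hF => ?_⟩
  obtain ⟨U, hU, hFU⟩ := h.2.2 F hF
  have hb : ∀ x : F, ∃ b ∈ B, x.1 ∈ b ∧ b ⊆ U := fun x =>
    (TopologicalSpace.isBasis_countableBasis X).exists_subset_of_mem_open (hFU x.2) (h.2.1 U hU)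
  choose b hbB hxb hbU using hb
  have := hF.to_subtype
  have hs : Set.range b ∈ C := ⟨⟨Set.finite_range b, Set.range_subset_iff.2 hbB⟩, U, hU, by
    simpa using hbU⟩
  exact ⟨u ⟨_, hs⟩, ⟨_, rfl⟩, fun x hx => hsu ⟨_, hs⟩ ⟨b ⟨x, hx⟩, ⟨_, rfl⟩, hxb _⟩⟩

theorem GammaSeq.hasGamma {X : Type*} [TopologicalSpace X] [SecondCountableTopology X]
    (h : GammaSeq X) : HasGamma X := by
  intro 𝒰 h𝒰
  obtain ⟨𝒰', hsub, hcount, hF⟩ := h𝒰.exists_countable_subset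
  have hx : ∀ V : Set X, ∃ x, V ∈ 𝒰 → x ∉ V := by
    intro V
    by_cases hV : V ∈ 𝒰
    · obtain ⟨x, hx⟩ := (Set.ne_univ_iff_exists_notMem V).1 (h𝒰.1.1 V hV)
      exact ⟨x, fun _ => hx⟩
    · obtain ⟨W, hW, -⟩ := hF ∅ Set.finite_empty
      obtain ⟨x, hx⟩ := (Set.ne_univ_iff_exists_notMem W).1 (h𝒰.1.1 W (hsub hW))
      exact ⟨x, fun h => absurd h hV⟩
  choose x hx using hx
  have hinf : ∀ F : Set X, F.Finite → {V ∈ 𝒰' | F ⊆ V}.Infinite := by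
    intro F hFf hfin
    -- If only finitely many members contained `F`, a member containing `F` and a point missed by
    -- each of them would be one of them and yet contain its own missed point.
    obtain ⟨V, hV, hFV⟩ := hF (F ∪ x '' {V ∈ 𝒰' | F ⊆ V}) (hFf.union (hfin.image x))
    refine hx V (hsub hV) (hFV (Or.inr ⟨V, ⟨hV, ?_⟩, rfl⟩))
    exact Set.subset_union_left.trans hFV
  obtain ⟨U, rfl⟩ := hcount.exists_eq_range (by
    obtain ⟨V, hV, -⟩ := hF ∅ Set.finite_empty
    exact ⟨V, hV⟩)
  have hUmem : ∀ n, U n ∈ 𝒰 := fun n => hsub ⟨n, rfl⟩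
  obtain ⟨φ, hφ, hφU⟩ := h U (fun n => h𝒰.2.1 _ (hUmem n)) (by
    intro F hFf
    rw [Nat.frequently_atTop_iff_infinite]
    refine Set.Infinite.of_image U ((hinf F hFf).mono ?_)
    rintro _ ⟨⟨n, rfl⟩, hn⟩
    exact ⟨n, hn, rfl⟩)
  refine ⟨Set.range (U ∘ φ), ?_, ?_, ⟨?_, ?_⟩, ?_⟩
  · rintro _ ⟨n, rfl⟩
    exact hUmem _
  · intro hfin
    obtain ⟨n, hn⟩ := ((eventually_all_finite hfin).2 fun V _ => hφU (x V)).exists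
    exact hx _ (hUmem (φ n)) (hn _ ⟨n, rfl⟩)
  · rintro _ ⟨n, rfl⟩
    exact h𝒰.1.1 _ (hUmem _)
  · refine Set.eq_univ_of_forall fun y => ?_
    obtain ⟨n, hn⟩ := (hφU y).exists
    exact ⟨_, ⟨n, rfl⟩, hn⟩
  · intro y
    have := hφU y
    rw [← Nat.cofinite_eq_atTop, Filter.eventually_cofinite] at this
    refine (this.image (U ∘ φ)).subset ?_
    rintro _ ⟨⟨n, rfl⟩, hn⟩
    exact ⟨n, hn, rfl⟩

theorem gammaSeq_of_mk_lt {X : Type} [TopologicalSpace X] (hX : #X < cardP) : GammaSeq X := by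
  intro U _ hF
  exact exists_strictMono_eventually_mem hX (fun x => {n | x ∈ U n}) hF

theorem GammaSeq.of_surjective {X Y : Type*} [TopologicalSpace X] [TopologicalSpace Y]
    (h : GammaSeq X) {f : X → Y} (hf : Continuous f) (hs : Function.Surjective f) :
    GammaSeq Y := by
  intro U hU hF
  obtain ⟨φ, hφ, hφU⟩ := h (fun n => f ⁻¹' U n) (fun n => (hU n).preimage hf)
    (fun F hFf => (hF _ (hFf.image f)).mono fun n hn => Set.image_subset_iff.1 hn)
  refine ⟨φ, hφ, fun y => ?_⟩
  obtain ⟨x, rfl⟩ := hs y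
  exact hφU x

theorem GammaSeq.of_isClosedEmbedding {X Y : Type*} [TopologicalSpace X] [TopologicalSpace Y]
    (h : GammaSeq Y) {f : X → Y} (hf : IsClosedEmbedding f) : GammaSeq X := by
  intro U hU hF
  have hpre : ∀ n, f ⁻¹' (f '' (U n)ᶜ)ᶜ = U n := fun n => by
    rw [Set.preimage_compl, Set.preimage_image_eq _ hf.injective, compl_compl]
  obtain ⟨φ, hφ, hφU⟩ := h (fun n => (f '' (U n)ᶜ)ᶜ)
    (fun n => (hf.isClosedMap _ (hU n).isClosed_compl).isOpen_compl) (by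
      intro F hFf
      refine (hF (f ⁻¹' F) (hFf.preimage hf.injective.injOn)).mono fun n hn y hy => ?_
      rintro ⟨x, hx, rfl⟩
      exact hx (hn hy))
  refine ⟨φ, hφ, fun x => ?_⟩
  filter_upwards [hφU (f x)] with n hn
  rw [← hpre]
  exact hn

theorem GammaSeq.exists_injective {X ι : Type*} [TopologicalSpace X] [Countable ι] [Infinite ι]
    (h : GammaSeq X) (U : ι → Set X) (hU : ∀ i, IsOpen (U i))
    (hF : ∀ F : Set X, F.Finite → {i | F ⊆ U i}.Infinite) :
    ∃ φ : ℕ → ι, Function.Injective φ ∧ ∀ x, ∀ᶠ n in atTop, x ∈ U (φ n) := by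
  obtain ⟨e⟩ := nonempty_equiv_of_countable (α := ℕ) (β := ι)
  obtain ⟨φ, hφ, hφU⟩ := h (U ∘ e) (fun n => hU _) (by
    intro F hFf
    rw [Nat.frequently_atTop_iff_infinite]
    exact (hF F hFf).preimage (f := e) (fun i _ => e.surjective i))
  exact ⟨e ∘ φ, e.injective.comp hφ.injective, hφU⟩

/-! ### Products with generalized tower sets -/

/-- The points of the Cantor space with finite support. -/
def finSet : Set (ℕ → Bool) := {χ | {n | χ n = true}.Finite}

theorem support_injective : Function.Injective fun χ : ℕ → Bool => {n | χ n = true} :=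
  fun _ _ h => funext fun n => Bool.eq_iff_iff.2 (Set.ext_iff.1 h n)

theorem countable_finSet : finSet.Countable := by
  have h : {t : Set ℕ | t.Finite}.Countable := by
    simpa using Set.countable_ofPred_finite_subset (Set.countable_univ (α := ℕ))
  exact h.preimage_of_injOn support_injective.injOn

theorem mk_finSet_lt : #finSet < cardP :=
  (Cardinal.le_aleph0_iff_set_countable.2 countable_finSet).trans_lt aleph0_lt_cardP

/-- The point of the Cantor space whose support is a given finite set. -/
def ofFinset (s : Finset ℕ) : ℕ → Bool := fun n => decide (n ∈ s)

theorem ofFinset_mem (s : Finset ℕ) : ofFinset s ∈ finSet := by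
  simp [ofFinset, finSet]

theorem ofFinset_singleton_injective : Function.Injective fun n => ofFinset {n} := by
  intro i j h
  simpa [ofFinset] using congrFun h i

/-- The point `x` has no element in the interval `[k, l)`. -/
def Misses (x : ℕ → Bool) (k l : ℕ) : Prop := ∀ i, k ≤ i → i < l → x i = false

/-- The tower property for subsets of the Cantor space. -/
def IsTowerLike (Z : Set (ℕ → Bool)) : Prop :=
  ∀ a : ℕ → ℕ, StrictMono a → ∃ (b : Set ℕ) (S : Set (ℕ → Bool)), b.Infinite ∧ S ⊆ Z ∧
    #S < cardP ∧ ∀ x ∈ Z, x ∉ S → ∀ᶠ n in atTop, n ∈ b → Misses x (a n) (a (n + 1))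

section

variable {Z : Set (ℕ → Bool)} {Y : Type*} [TopologicalSpace Y]

/-- The interior of the set of all `y` such that `(x, y)` is in `W` for each `x ∈ Z` that misses
the interval `[k, l)`. -/
def missCore (k l : ℕ) (W : Set (Z × Y)) : Set Y :=
  interior {y | ∀ x : Z, Misses x k l → (x, y) ∈ W}

theorem exists_agree_subset {s : Z} {u : Set Z} (hu : u ∈ 𝓝 s) :
    ∃ L, ∀ x : Z, (∀ i < L, x.1 i = s.1 i) → x ∈ u := by
  rw [nhds_subtype, mem_comap] at hu
  obtain ⟨v, hv, hvu⟩ := hu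
  rw [nhds_pi, Filter.mem_pi] at hv
  obtain ⟨I, hI, t, ht, hIt⟩ := hv
  obtain ⟨M, hM⟩ := hI.bddAbove
  refine ⟨M + 1, fun x hx => hvu (hIt fun i hi => ?_)⟩
  rw [hx i (Nat.lt_succ_of_le (hM hi))]
  exact mem_of_mem_nhds (ht i)

/-- A point missing `[k, l)` agrees below `l` with its trace on `[0, k)`, so only the finitely many
`s ⊆ [0, k)` need neighbourhoods. -/
theorem eventually_mem_missCore (hZ : finSet ⊆ Z) {W : Set (Z × Y)} (hW : IsOpen W) (k : ℕ)
    (y : Y) (h : ∀ s ∈ (Finset.range k).powerset, (⟨ofFinset s, hZ (ofFinset_mem s)⟩, y) ∈ W) :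
    ∀ᶠ l in atTop, y ∈ missCore k l W := by
  have h1 : ∀ s ∈ (Finset.range k).powerset, ∀ᶠ l in atTop, ∀ᶠ y' in 𝓝 y, ∀ x : Z,
      (∀ i < l, x.1 i = ofFinset s i) → (x, y') ∈ W := by
    intro s hs
    have h2 := hW.mem_nhds (h s hs)
    rw [nhds_prod_eq, mem_prod_iff] at h2
    obtain ⟨u, hu, v, hv, huv⟩ := h2
    obtain ⟨L, hL⟩ := exists_agree_subset hu
    filter_upwards [eventually_ge_atTop L] with l hl
    filter_upwards [hv] with y' hy' x hx
    exact huv ⟨hL x fun i hi => hx i (hi.trans_le hl), hy'⟩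
  filter_upwards [(eventually_all_finset _).2 h1] with l hl
  refine mem_interior_iff_mem_nhds.2 ?_
  filter_upwards [(eventually_all_finset _).2 hl] with y' hy' x hx
  refine hy' ((Finset.range k).filter fun i => x.1 i = true)
    (Finset.mem_powerset.2 (Finset.filter_subset _ _)) x fun i hi => ?_
  by_cases hik : i < k
  · simp [ofFinset, hik]
  · rw [hx i (not_lt.1 hik) hi]
    simp [ofFinset, hik]

/-- The part of the `m`-th member of `U` over the core determined by `[k, l)`, for
`p = (k, l, m)`. -/
def coreSet (U : ℕ → Set (Z × Y)) (p : ℕ × ℕ × ℕ) : Set (Z × Y) :=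
  {q | q ∈ U p.2.2 ∧ q.2 ∈ missCore p.1 p.2.1 (U p.2.2)}

theorem isOpen_coreSet {U : ℕ → Set (Z × Y)} (hU : ∀ n, IsOpen (U n)) (p : ℕ × ℕ × ℕ) :
    IsOpen (coreSet U p) :=
  (hU _).inter (isOpen_interior.preimage continuous_snd)

theorem mem_coreSet_of_misses {U : ℕ → Set (Z × Y)} {p : ℕ × ℕ × ℕ} {x : Z} {y : Y}
    (hx : Misses x p.1 p.2.1) (hy : y ∈ missCore p.1 p.2.1 (U p.2.2)) : (x, y) ∈ coreSet U p :=
  ⟨interior_subset (s := {y | ∀ x : Z, Misses x p.1 p.2.1 → (x, y) ∈ U p.2.2}) hy x hx, hy⟩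

theorem exists_coreSet_sequence [Nonempty Y] {U : ℕ → Set (Z × Y)}
    (hU : ∀ n, IsOpen (U n)) {T : Set (ℕ → Bool)} (hT : finSet ⊆ T) (hTZ : T ⊆ Z)
    (hγ : GammaSeq (T × Y)) {P : Set (ℕ × ℕ × ℕ)} (hP : ∀ p ∈ P, p.1 < p.2.1 ∧ p.1 ≤ p.2.2)
    (hF : ∀ F : Set (Z × Y), F.Finite → (∀ q ∈ F, q.1.1 ∈ T) → ∀ N, ∃ p ∈ P, N ≤ p.1 ∧
      F ⊆ coreSet U p) :
    ∃ p : ℕ → ℕ × ℕ × ℕ, (∀ j, p j ∈ P) ∧ (∀ j, (p j).2.1 ≤ (p (j + 1)).1) ∧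
      StrictMono (fun j => (p j).2.2) ∧
      ∀ q : Z × Y, q.1.1 ∈ T → ∀ᶠ j in atTop, q ∈ coreSet U (p j) := by
  let ι : T × Y → Z × Y := fun q => (⟨q.1.1, hTZ q.1.2⟩, q.2)
  have hι : Continuous ι := by fun_prop
  -- The last condition forces the left endpoints to infinity: the point with support `{i}` excludes
  -- all triples with `k = i`. The constant condition `p ∈ P` makes the selected triples eventually
  -- lie in `P`.
  obtain ⟨φ, hφ, hφW⟩ := hγ.exists_injective
    (fun p : ℕ × ℕ × ℕ => {q : T × Y | p ∈ P ∧ ι q ∈ coreSet U p ∧ q.1.1 ≠ ofFinset {p.1}})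
    (fun p => by
      refine isOpen_const.and (((isOpen_coreSet hU p).preimage hι).and ?_)
      exact isOpen_ne_fun (by fun_prop) continuous_const) (by
    intro F hFf hfin
    obtain ⟨M, hM⟩ := (hfin.image Prod.fst).bddAbove
    have h1 : ∀ᶠ n in atTop, ∀ q ∈ F, q.1.1 ≠ ofFinset {n} := by
      refine (eventually_all_finite hFf).2 fun q _ => ?_
      rw [← Nat.cofinite_eq_atTop, Filter.eventually_cofinite]
      refine Set.Subsingleton.finite fun i hi j hj => ofFinset_singleton_injective ?_
      exact (not_not.1 hi).symm.trans (not_not.1 hj)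
    obtain ⟨N, hN⟩ := eventually_atTop.1 h1
    obtain ⟨p, hpP, hp, hpF⟩ := hF (ι '' F) (hFf.image ι)
      (by rintro _ ⟨q, -, rfl⟩; exact q.1.2) (max N (M + 1))
    have := hM ⟨p, fun q hq => ⟨hpP, hpF ⟨q, hq, rfl⟩, hN _ ((le_max_left _ _).trans hp) q hq⟩, rfl⟩
    have := (le_max_right N (M + 1)).trans hp
    omega)
  obtain ⟨y₀⟩ := ‹Nonempty Y›
  have hk : ∀ N, ∀ᶠ n in atTop, φ n ∈ P ∧ N ≤ (φ n).1 := by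
    intro N
    have h1 : ∀ᶠ n in atTop, ∀ i ∈ Set.Iio N, (φ n).1 ≠ i := by
      refine (eventually_all_finite (Set.finite_Iio N)).2 fun i _ => ?_
      filter_upwards [hφW (⟨ofFinset {i}, hT (ofFinset_mem _)⟩, y₀)] with n hn hi
      exact hn.2.2 (by rw [hi])
    filter_upwards [h1, hφW (⟨ofFinset ∅, hT (ofFinset_mem _)⟩, y₀)] with n hn hn'
    exact ⟨hn'.1, not_lt.1 fun h => hn _ h rfl⟩
  have hnext : ∀ n, ∃ n', n < n' ∧ φ n' ∈ P ∧ (φ n).2.1 ≤ (φ n').1 ∧ (φ n).2.2 < (φ n').2.2 := by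
    intro n
    obtain ⟨n', h1, h2, h3⟩ :=
      ((eventually_gt_atTop n).and (hk (max (φ n).2.1 ((φ n).2.2 + 1)))).exists
    exact ⟨n', h1, h2, (le_max_left _ _).trans h3,
      ((le_max_right _ _).trans h3).trans (hP _ h2).2⟩
  choose g hg using hnext
  obtain ⟨n₀, hn₀, -⟩ := (hk 0).exists
  let ψ : ℕ → ℕ := fun j => g^[j] n₀
  have hψs : ∀ j, ψ (j + 1) = g (ψ j) := fun j => Function.iterate_succ_apply' g j n₀
  have hψ : StrictMono ψ := strictMono_nat_of_lt_succ fun j => by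
    rw [hψs]
    exact (hg _).1
  refine ⟨φ ∘ ψ, fun j => ?_, fun j => ?_, strictMono_nat_of_lt_succ fun j => ?_, fun q hq => ?_⟩
  · cases j with
    | zero => exact hn₀
    | succ j =>
      simp only [Function.comp, hψs]
      exact (hg _).2.1
  · simp only [Function.comp, hψs]
    exact (hg _).2.2.1
  · simp only [Function.comp, hψs]
    exact (hg _).2.2.2
  · exact (hψ.tendsto_atTop.eventually (hφW (⟨q.1.1, hq⟩, q.2))).mono fun j hj => hj.2.1

/-- One step of the iteration: only the points over `S' \ S` remain uncontrolled. -/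
theorem exists_coreSet_step [Nonempty Y] (hZ : finSet ⊆ Z) (hZt : IsTowerLike Z)
    (hγ : ∀ S : Set (ℕ → Bool), #S < cardP → GammaSeq (S × Y)) {U : ℕ → Set (Z × Y)}
    (hU : ∀ n, IsOpen (U n)) (hF : ∀ F : Set (Z × Y), F.Finite → ∃ᶠ n in atTop, F ⊆ U n)
    {S : Set (ℕ → Bool)} (hS : finSet ⊆ S) (hSZ : S ⊆ Z) (hSc : #S < cardP) :
    ∃ (p : ℕ → ℕ × ℕ × ℕ) (S' : Set (ℕ → Bool)), S ⊆ S' ∧ S' ⊆ Z ∧ #S' < cardP ∧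
      (∀ j, (p j).1 < (p j).2.1 ∧ (p j).1 ≤ (p j).2.2) ∧ StrictMono (fun j => (p j).1) ∧
      ∀ q : Z × Y, q.1.1 ∈ S ∨ q.1.1 ∉ S' → ∀ᶠ j in atTop, q ∈ coreSet U (p j) := by
  obtain ⟨p, hpP, hpl, -, hpq⟩ := exists_coreSet_sequence (P := {p | p.1 < p.2.1 ∧ p.1 ≤ p.2.2})
    hU hS hSZ (hγ S hSc) (fun p hp => hp) (by
      intro F hFf _ N
      -- Adding `(s, y)` for all `s ⊆ [0, N)` puts each `y` in the core of the chosen `U m` for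
      -- large `l`.
      let G : Set (Z × Y) := F ∪ ⋃ s ∈ ((Finset.range N).powerset : Finset (Finset ℕ)),
        (fun q : Z × Y => ((⟨ofFinset s, hZ (ofFinset_mem s)⟩ : Z), q.2)) '' F
      have hG : G.Finite := hFf.union (Set.Finite.biUnion (Finset.finite_toSet _)
        fun s _ => hFf.image _)
      obtain ⟨m, hm, hNm⟩ := ((hF G hG).and_eventually (eventually_ge_atTop N)).exists
      have hl : ∀ᶠ l in atTop, ∀ q ∈ F, q.2 ∈ missCore N l (U m) := by
        refine (eventually_all_finite hFf).2 fun q hq => ?_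
        refine eventually_mem_missCore hZ (hU m) N q.2 fun s hs => hm (Or.inr ?_)
        exact Set.mem_biUnion hs ⟨q, hq, rfl⟩
      obtain ⟨l, hl, hNl⟩ := (hl.and (eventually_gt_atTop N)).exists
      exact ⟨(N, l, m), ⟨hNl, hNm⟩, le_rfl, fun q hq => ⟨hm (Or.inl hq), hl q hq⟩⟩)
  have hpk : StrictMono (fun j => (p j).1) :=
    strictMono_nat_of_lt_succ fun j => (hpP j).1.trans_le (hpl j)
  obtain ⟨b, S', hb, hS'Z, hS'c, hS'⟩ := hZt _ hpk
  have hν := Nat.nth_strictMono hb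
  refine ⟨p ∘ Nat.nth (· ∈ b), S ∪ S', Set.subset_union_left, Set.union_subset hSZ hS'Z,
    (mk_union_le _ _).trans_lt (add_lt_of_lt aleph0_lt_cardP.le hSc hS'c), fun j => hpP _,
    hpk.comp hν, fun q hq => ?_⟩
  have hν' := hν.tendsto_atTop
  rcases hq with hq | hq
  · exact hν'.eventually (hpq q hq)
  -- The point over `∅` lies over `S`, so it shows that `q.2` is eventually in the core; missing the
  -- interval does the rest.
  · have h1 := hpq ((⟨ofFinset ∅, hZ (ofFinset_mem _)⟩ : Z), q.2) (hS (ofFinset_mem ∅))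
    filter_upwards [hν'.eventually (hS' q.1 q.1.2 fun h => hq (Or.inr h)), hν'.eventually h1]
      with j hj hj'
    refine mem_coreSet_of_misses (fun i hi hi' => ?_) hj'.2
    exact hj (Nat.nth_mem_of_infinite hb j) i hi (hi'.trans_le (hpl _))

theorem gammaSeq_towerLike_prod (hZ : finSet ⊆ Z) (hZt : IsTowerLike Z)
    (hγ : ∀ S : Set (ℕ → Bool), #S < cardP → GammaSeq (S × Y)) : GammaSeq (Z × Y) := by
  intro U hU hF
  rcases isEmpty_or_nonempty Y with hY | hY
  · exact ⟨id, strictMono_id, fun q => hY.elim q.2⟩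
  let σ := {S : Set (ℕ → Bool) // finSet ⊆ S ∧ S ⊆ Z ∧ #S < cardP}
  have hstep := fun S : σ => exists_coreSet_step hZ hZt hγ hU hF S.2.1 S.2.2.1 S.2.2.2
  choose p S' hSS' hS'Z hS'c hp hpk hpq using hstep
  let g : σ → σ := fun S => ⟨S' S, S.2.1.trans (hSS' S), hS'Z S, hS'c S⟩
  let S : ℕ → σ := fun i => g^[i] ⟨finSet, subset_rfl, hZ, mk_finSet_lt⟩
  have hSs : ∀ i, S (i + 1) = g (S i) := fun i => Function.iterate_succ_apply' g i _
  have hmono : Monotone fun i => (S i).1 := monotone_nat_of_le_succ fun i => by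
    rw [hSs]
    exact hSS' _
  have hSω := mk_iUnion_lt_cardP hmono fun i => (S i).2.2.2
  -- Arranges that `[a n, a (n + 1))` contains an interval of each of the first `n + 1` sequences.
  have hc : ∀ n x, ∃ c, x < c ∧ ∀ i ≤ n, ∃ j, x ≤ (p (S i) j).1 ∧ (p (S i) j).2.1 ≤ c := by
    intro n x
    have : ∀ᶠ c in atTop, ∀ i ∈ Set.Iic n, ∃ j, x ≤ (p (S i) j).1 ∧ (p (S i) j).2.1 ≤ c := by
      refine (eventually_all_finite (Set.finite_Iic n)).2 fun i _ => ?_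
      filter_upwards [eventually_ge_atTop (p (S i) x).2.1] with c hc
      exact ⟨x, (hpk (S i)).le_apply, hc⟩
    exact ((eventually_gt_atTop x).and this).exists
  choose c hxc hc using hc
  let a : ℕ → ℕ := fun n => Nat.rec 0 (fun n x => c n x) n
  have has : ∀ n, a (n + 1) = c n (a n) := fun n => rfl
  have ha : StrictMono a := strictMono_nat_of_lt_succ fun n => hxc n (a n)
  obtain ⟨b, S₁, hb, hS₁Z, hS₁c, hS₁⟩ := hZt a ha
  let T := (⋃ i, (S i).1) ∪ S₁
  have hTc : #T < cardP :=
    (mk_union_le _ _).trans_lt (add_lt_of_lt aleph0_lt_cardP.le hSω hS₁c)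
  have hT : finSet ⊆ T := fun x hx => Or.inl (Set.mem_iUnion.2 ⟨0, hx⟩)
  have hTZ : T ⊆ Z := Set.union_subset (Set.iUnion_subset fun i => (S i).2.2.1) hS₁Z
  obtain ⟨r, hrP, hrl, hrm, hrq⟩ := exists_coreSet_sequence
    (P := {t | (∃ i j, p (S i) j = t) ∧ ∃ n ∈ b, a n ≤ t.1 ∧ t.2.1 ≤ a (n + 1)})
    hU hT hTZ (hγ T hTc) (by
      rintro _ ⟨⟨i, j, rfl⟩, -⟩
      exact hp _ _) (by
    intro F hFf _ N
    -- Since `S (i + 1)` is `S' (S i)`, a point in no `S i` lies outside every `S' (S i)`. Hence a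
    -- single late sequence handles all of `F`.
    have h1 : ∀ᶠ i in atTop, ∀ q ∈ F, q.1.1 ∈ (S i).1 ∨ q.1.1 ∉ S' (S i) := by
      refine (eventually_all_finite hFf).2 fun q _ => ?_
      by_cases hq : ∃ i, q.1.1 ∈ (S i).1
      · obtain ⟨i, hi⟩ := hq
        filter_upwards [eventually_ge_atTop i] with i' hi'
        exact Or.inl (hmono hi' hi)
      · refine .of_forall fun i => Or.inr fun h => hq ⟨i + 1, ?_⟩
        rw [hSs]
        exact h
    obtain ⟨i, hi⟩ := h1.exists
    have h2 : ∀ᶠ j in atTop, ∀ q ∈ F, q ∈ coreSet U (p (S i) j) :=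
      (eventually_all_finite hFf).2 fun q hq => hpq _ _ (hi q hq)
    obtain ⟨J, hJ⟩ := eventually_atTop.1 h2
    obtain ⟨n, hnb, hn⟩ := hb.exists_gt (max (max i N) (p (S i) J).1)
    obtain ⟨j, hj, hj'⟩ := hc n (a n) i (by omega)
    have han : n ≤ a n := ha.le_apply
    have hJj : J ≤ j := (hpk (S i)).le_iff_le.1 (by omega)
    exact ⟨_, ⟨⟨i, j, rfl⟩, n, hnb, hj, hj'⟩, by omega, hJ j hJj⟩)
  refine ⟨fun j => (r j).2.2, hrm, fun q => ?_⟩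
  by_cases hq : q.1.1 ∈ T
  · exact (hrq q hq).mono fun j hj => hj.1
  have h1 := hrq ((⟨ofFinset ∅, hZ (ofFinset_mem _)⟩ : Z), q.2) (hT (ofFinset_mem ∅))
  obtain ⟨N, hN⟩ := eventually_atTop.1 (hS₁ q.1 q.1.2 fun h => hq (Or.inr h))
  have hkl : ∀ j, (r j).1 < (r j).2.1 := fun j => by
    obtain ⟨⟨i, j', h⟩, -⟩ := hrP j
    rw [← h]
    exact (hp _ _).1
  have hrk : StrictMono fun j => (r j).1 :=
    strictMono_nat_of_lt_succ fun j => (hkl j).trans_le (hrl j)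
  filter_upwards [h1, eventually_ge_atTop (a N)] with j hj hjN
  obtain ⟨-, n, hnb, hn, hn'⟩ := hrP j
  have hNn : N ≤ n := by
    by_contra! h
    have h2 : a (n + 1) ≤ a N := ha.monotone h
    have h3 : j ≤ (r j).1 := hrk.le_apply
    have h4 := hkl j
    omega
  refine (mem_coreSet_of_misses (x := q.1) (fun i hi hi' => ?_) hj.2).1
  exact hN n hNn hnb i (hn.trans hi) (hi'.trans_le hn')

end

/-! ### Generalized tower sets as subsets of the Cantor space -/

theorem IsGeneralizedTowerSet.finSet_subset {κ : Cardinal} {Z : Set (ℕ → Bool)}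
    (h : IsGeneralizedTowerSet κ Z) : finSet ⊆ Z := by
  obtain ⟨X, -, rfl⟩ := h
  exact fun χ hχ => Or.inr hχ

theorem IsGeneralizedTowerSet.isTowerLike {Z : Set (ℕ → Bool)}
    (h : IsGeneralizedTowerSet cardP Z) : IsTowerLike Z := by
  obtain ⟨X, ⟨-, -, hX⟩, rfl⟩ := h
  intro a ha
  obtain ⟨b, S, hb, hSX, hS, hxS⟩ := hX a ha
  refine ⟨b, {χ | {n | χ n = true} ∈ S}, hb, fun χ hχ => Or.inl (hSX hχ), ?_, fun x hx hxS' => ?_⟩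
  · refine (mk_le_of_injective (f := fun χ : {χ : ℕ → Bool | {n | χ n = true} ∈ S} =>
      (⟨{n | χ.1 n = true}, χ.2⟩ : S)) fun χ χ' h => ?_).trans_lt hS
    exact Subtype.ext (support_injective (Subtype.ext_iff.1 h))
  · have hfin : ({n | x n = true} ∩ ⋃ n ∈ b, Set.Ico (a n) (a (n + 1))).Finite := by
      rcases hx with hx | hx
      · exact hxS _ ⟨hx, hxS'⟩
      · exact Set.Finite.inter_of_left hx _
    obtain ⟨M, hM⟩ := hfin.bddAbove
    filter_upwards [eventually_gt_atTop M] with n hn hnb i hi hi'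
    by_contra hxi
    have h1 := hM ⟨Bool.eq_true_of_not_eq_false hxi, Set.mem_biUnion hnb ⟨hi, hi'⟩⟩
    have h2 : n ≤ a n := ha.le_apply
    omega

/-! ### Spaces whose products with small sets have property γ -/

/-- The products of `Y` with all sets of cardinality less than `𝔭` have property γ, in its
sequential form. -/
def SmallProductGamma (Y : Type*) [TopologicalSpace Y] : Prop :=
  ∀ S : Set (ℕ → Bool), #S < cardP → GammaSeq (S × Y)

section

variable {Y : Type*} [TopologicalSpace Y]

theorem SmallProductGamma.gammaSeq (h : SmallProductGamma Y) : GammaSeq Y := by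
  have h1 : #({fun _ => false} : Set (ℕ → Bool)) < cardP := by
    rw [mk_singleton]
    exact one_lt_aleph0.trans aleph0_lt_cardP
  exact (h _ h1).of_surjective continuous_snd fun y => ⟨(⟨_, rfl⟩, y), rfl⟩

theorem SmallProductGamma.of_surjective {Y' : Type*} [TopologicalSpace Y']
    (h : SmallProductGamma Y) {f : Y → Y'} (hf : Continuous f) (hs : Function.Surjective f) :
    SmallProductGamma Y' := fun S hS =>
  (h S hS).of_surjective (continuous_id.prodMap hf) (Function.surjective_id.prodMap hs)

/-- Interleaving codes `S' × S` by a single small subset of the Cantor space. -/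
theorem SmallProductGamma.small_prod (h : SmallProductGamma Y) {S : Set (ℕ → Bool)}
    (hS : #S < cardP) : SmallProductGamma (S × Y) := by
  intro S' hS'
  let R : Set (ℕ → Bool) := {x | (fun n => x (2 * n)) ∈ S' ∧ (fun n => x (2 * n + 1)) ∈ S}
  have hR : #R < cardP := by
    refine lt_of_le_of_lt (mk_le_of_injective (f := fun x : R =>
      ((⟨_, x.2.1⟩, ⟨_, x.2.2⟩) : S' × S)) fun x x' hx => ?_) (b := #(S' × S)) ?_
    · simp only [Prod.mk.injEq, Subtype.mk.injEq] at hx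
      refine Subtype.ext (funext fun i => ?_)
      obtain ⟨n, rfl | rfl⟩ := Nat.even_or_odd' i
      · exact congrFun hx.1 n
      · exact congrFun hx.2 n
    · rw [mk_prod, lift_id, lift_id]
      exact mul_lt_of_lt aleph0_lt_cardP.le hS' hS
  refine (h R hR).of_surjective
    (f := fun q => (⟨_, q.1.2.1⟩, (⟨_, q.1.2.2⟩, q.2))) ?_ ?_
  · have h1 : Continuous fun q : R × Y => q.1.1 := continuous_subtype_val.comp continuous_fst
    exact (Continuous.subtype_mk (continuous_pi fun n => (continuous_apply _).comp h1) _).prodMk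
      ((Continuous.subtype_mk (continuous_pi fun n => (continuous_apply _).comp h1) _).prodMk
        continuous_snd)
  rintro ⟨s', s, y⟩
  have h1 : (fun n => (fun i => if i % 2 = 0 then s'.1 (i / 2) else s.1 (i / 2)) (2 * n)) = s'.1 := by
    funext n
    simp
  have h2 : (fun n => (fun i => if i % 2 = 0 then s'.1 (i / 2) else s.1 (i / 2)) (2 * n + 1))
      = s.1 := by
    funext n
    have e1 : (2 * n + 1) % 2 = 1 := by omega
    have e2 : (2 * n + 1) / 2 = n := by omega
    simp [e1, e2]
  refine ⟨(⟨fun i => if i % 2 = 0 then s'.1 (i / 2) else s.1 (i / 2), ?_, ?_⟩, y), ?_⟩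
  · rw [h1]
    exact s'.2
  · rw [h2]
    exact s.2
  · exact Prod.ext (Subtype.ext h1) (Prod.ext (Subtype.ext h2) rfl)

theorem SmallProductGamma.tower_prod (h : SmallProductGamma Y) {Z : Set (ℕ → Bool)}
    (hZ : IsGeneralizedTowerSet cardP Z) : SmallProductGamma (Z × Y) := by
  intro S hS
  refine (gammaSeq_towerLike_prod hZ.finSet_subset hZ.isTowerLike (h.small_prod hS)).of_surjective
    (f := fun q => (q.2.1, (q.1, q.2.2))) (by fun_prop) ?_
  rintro ⟨s, z, y⟩
  exact ⟨(z, s, y), rfl⟩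

end

theorem smallProductGamma_pi (m : ℕ) (Z : Fin m → Set (ℕ → Bool))
    (hZ : ∀ i, IsGeneralizedTowerSet cardP (Z i)) : SmallProductGamma (∀ i, Z i) := by
  induction m with
  | zero =>
    intro S hS
    refine gammaSeq_of_mk_lt ?_
    simpa using hS
  | succ m ih =>
    refine ((ih (fun i => Z i.succ) fun i => hZ _).tower_prod (hZ 0)).of_surjective
      (f := fun q => (Fin.cons q.1 q.2 : ∀ i, Z i)) ?_ ?_
    · refine continuous_pi fun i => ?_
      refine Fin.cases ?_ (fun i => ?_) i
      · exact continuous_fst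
      · exact (continuous_apply i).comp continuous_snd
    · exact fun w => ⟨(w 0, Fin.tail w), Fin.cons_self_tail w⟩

theorem IsSetOfReals.secondCountableTopology {Y : Type*} [TopologicalSpace Y]
    (h : IsSetOfReals Y) : SecondCountableTopology Y := by
  obtain ⟨A, ⟨e⟩⟩ := h
  exact e.secondCountableTopology

theorem isSetOfReals_subset_cantor (S : Set (ℕ → Bool)) : IsSetOfReals S :=
  ⟨_, ⟨((IsEmbedding.subtypeVal.comp cantorSetHomeomorphNatToBool.symm.isEmbedding).comp
    IsEmbedding.subtypeVal).toHomeomorph⟩⟩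

/-! ### Small sets of reals -/

theorem IsSetOfReals.exists_isEmbedding {A : Type} [TopologicalSpace A] (h : IsSetOfReals A)
    (hA : #A < 𝔠) : ∃ f : A → ℕ → Bool, IsEmbedding f := by
  obtain ⟨B, ⟨e⟩⟩ := h
  have hB : #B < 𝔠 := by rwa [← mk_congr e.toEquiv]
  -- As `#B < 𝔠`, some translate of `ℚ` misses `B`; cuts at its points are clopen in `B` and
  -- separate points from closed sets.
  obtain ⟨t, ht⟩ : ∃ t : ℝ, ∀ x ∈ B, ∀ q : ℚ, t + q ≠ x := by
    have h1 : #(Set.range fun p : B × ℚ => p.1.1 - (p.2 : ℝ)) < 𝔠 := by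
      refine mk_range_le.trans_lt ?_
      rw [mk_prod, lift_id, lift_id]
      exact mul_lt_of_lt aleph0_le_continuum hB (by simpa using aleph0_lt_continuum)
    have h2 : (Set.range fun p : B × ℚ => p.1.1 - (p.2 : ℝ)) ≠ Set.univ := by
      intro h
      rw [h, mk_univ, mk_real] at h1
      exact lt_irrefl _ h1
    obtain ⟨t, ht⟩ := (Set.ne_univ_iff_exists_notMem _).1 h2
    exact ⟨t, fun x hx q hq => ht ⟨(⟨x, hx⟩, q), by simp [← hq]⟩⟩
  let r : ℕ ≃ ℚ := (Denumerable.eqv ℚ).symm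
  let f : B → ℕ → Bool := fun x n => decide (t + r n < x)
  have hf : Continuous f := by
    refine continuous_pi fun n => (continuous_bool_rng true).2 ?_
    have h1 : (fun x : B => f x n) ⁻¹' {true} = {x : B | t + (r n : ℝ) < x} := by
      ext x
      simp [f]
    have h2 : {x : B | t + (r n : ℝ) < x} = {x : B | t + (r n : ℝ) ≤ x} := by
      ext x
      change t + (r n : ℝ) < x ↔ t + (r n : ℝ) ≤ x
      exact ⟨le_of_lt, fun h => lt_of_le_of_ne h (ht x x.2 _)⟩
    rw [h1]
    refine ⟨?_, isOpen_lt continuous_const continuous_subtype_val⟩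
    rw [h2]
    exact isClosed_le continuous_const continuous_subtype_val
  have hfi : IsInducing f := by
    refine isInducing_iff_nhds.2 fun x => le_antisymm (map_le_iff_le_comap.1 hf.continuousAt) ?_
    intro u hu
    rw [nhds_subtype, mem_comap] at hu
    obtain ⟨v, hv, hvu⟩ := hu
    obtain ⟨c, d, ⟨hc, hd⟩, hcd⟩ := mem_nhds_iff_exists_Ioo_subset.1 hv
    obtain ⟨q, hq, hq'⟩ := exists_rat_btwn (sub_lt_sub_right hc t)
    obtain ⟨q', hq'x, hq'd⟩ := exists_rat_btwn (sub_lt_sub_right hd t)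
    refine mem_comap.2 ⟨{w | w (r.symm q) = true ∧ w (r.symm q') = false}, ?_, ?_⟩
    · refine IsOpen.mem_nhds ?_ ?_
      · exact ((isOpen_discrete ({true} : Set Bool)).preimage
          (continuous_apply (A := fun _ : ℕ => Bool) (r.symm q))).inter
          ((isOpen_discrete ({false} : Set Bool)).preimage
            (continuous_apply (A := fun _ : ℕ => Bool) (r.symm q')))
      · simp only [f, Set.mem_ofPred_eq, Equiv.apply_symm_apply, decide_eq_true_eq,
          decide_eq_false_iff_not, not_lt]
        constructor <;> linarith
    · intro y hy
      simp only [f, Set.mem_preimage, Set.mem_ofPred_eq, Equiv.apply_symm_apply,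
        decide_eq_true_eq, decide_eq_false_iff_not, not_lt] at hy
      exact hvu (hcd ⟨by linarith, by linarith⟩)
  exact ⟨f ∘ e, hfi.isEmbedding.comp e.isEmbedding⟩

/-- The coding of subsets of `ℕ` by infinite sets that have exactly one element in each of the
intervals `{2n, 2n+1}`. -/
def doubleCode (x : ℕ → Bool) : ℕ → Bool := fun i => if i % 2 = 0 then x (i / 2) else !x (i / 2)

theorem doubleCode_even (x : ℕ → Bool) (n : ℕ) : doubleCode x (2 * n) = x n := by
  simp [doubleCode]

theorem doubleCode_odd (x : ℕ → Bool) (n : ℕ) : doubleCode x (2 * n + 1) = !x n := by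
  have e1 : (2 * n + 1) % 2 = 1 := by omega
  have e2 : (2 * n + 1) / 2 = n := by omega
  simp [doubleCode, e1, e2]

theorem isClosedEmbedding_doubleCode : IsClosedEmbedding doubleCode := by
  refine Continuous.isClosedEmbedding (continuous_pi fun i => ?_) fun x y h => funext fun n => ?_
  · by_cases hi : i % 2 = 0
    · simpa [doubleCode, hi] using continuous_apply (i / 2)
    · simpa [doubleCode, hi, Function.comp_def] using
        (continuous_of_discreteTopology (f := Bool.not)).comp (continuous_apply (i / 2))
  · rw [← doubleCode_even x, h, doubleCode_even]

theorem infinite_doubleCode_inter (x : ℕ → Bool) {b : Set ℕ} (hb : b.Infinite) :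
    ({i | doubleCode x i = true} ∩ ⋃ n ∈ b, Set.Ico (2 * n) (2 * (n + 1))).Infinite := by
  refine Set.infinite_of_injOn_mapsTo (f := fun n => if x n = true then 2 * n else 2 * n + 1)
    (s := b) (fun i _ j _ hij => ?_) (fun n hn => ⟨?_, Set.mem_biUnion hn ?_⟩) hb
  · dsimp only at hij
    split_ifs at hij <;> omega
  · by_cases h : x n = true
    · simp [h, doubleCode_even]
    · simp [h, doubleCode_odd]
  · dsimp only
    split_ifs <;> constructor <;> omega

theorem infinite_doubleCode (x : ℕ → Bool) : {i | doubleCode x i = true}.Infinite :=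
  (infinite_doubleCode_inter x Set.infinite_univ).mono Set.inter_subset_left

theorem exists_towerSet_isClosedEmbedding {X : Set (Set ℕ)} (hX : IsGeneralizedTower cardP X)
    {A : Type} [TopologicalSpace A] (hA : #A < cardP) {f : A → ℕ → Bool} (hf : IsEmbedding f) :
    ∃ Z : Set (ℕ → Bool), IsGeneralizedTowerSet cardP Z ∧ ∃ h : A → Z, IsClosedEmbedding h := by
  obtain ⟨hXinf, hXc, hXt⟩ := hX
  let s : (ℕ → Bool) → Set ℕ := fun x => {i | doubleCode x i = true}
  have hs : Function.Injective s := support_injective.comp isClosedEmbedding_doubleCode.injective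
  let A' : Set (Set ℕ) := Set.range (s ∘ f)
  have hA' : #A' < cardP := mk_range_le.trans_lt hA
  have hXs : #(X ∩ Set.range s : Set (Set ℕ)) < cardP := by
    -- For these intervals every code meets the union in an infinite set, so all codes in `X` are
    -- exceptional.
    obtain ⟨b, S, hb, -, hS, hxS⟩ := hXt (fun n => 2 * n) fun i j hij => by dsimp only; omega
    refine (mk_le_mk_of_subset ?_).trans_lt hS
    rintro _ ⟨hx, y, rfl⟩
    by_contra hyS
    exact infinite_doubleCode_inter y hb (hxS _ ⟨hx, hyS⟩)
  let X' : Set (Set ℕ) := A' ∪ X \ Set.range s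
  have hX' : IsGeneralizedTower cardP X' := by
    refine ⟨?_, ?_, fun a ha => ?_⟩
    · rintro _ (⟨x, rfl⟩ | hx)
      · exact infinite_doubleCode _
      · exact hXinf _ hx.1
    · by_contra! h
      refine absurd hXc (not_le.2 ?_)
      refine (mk_le_mk_of_subset (t := (X ∩ Set.range s) ∪ X') fun x hx => ?_).trans_lt
        ((mk_union_le _ _).trans_lt (add_lt_of_lt aleph0_lt_cardP.le hXs h))
      by_cases hxs : x ∈ Set.range s
      · exact Or.inl ⟨hx, hxs⟩
      · exact Or.inr (Or.inr ⟨hx, hxs⟩)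
    · obtain ⟨b, S, hb, hSX, hS, hxS⟩ := hXt a ha
      refine ⟨b, A' ∪ S \ Set.range s, hb,
        Set.union_subset_union_right _ (Set.sdiff_subset_sdiff_left hSX), ?_, ?_⟩
      · exact (mk_union_le _ _).trans_lt (add_lt_of_lt aleph0_lt_cardP.le hA'
          ((mk_le_mk_of_subset Set.sdiff_subset).trans_lt hS))
      · rintro x ⟨hx | hx, hx'⟩
        · exact absurd (Or.inl hx) hx'
        · exact hxS x ⟨hx.1, fun h => hx' (Or.inr ⟨h, hx.2⟩)⟩
  let Z : Set (ℕ → Bool) := {χ | {n | χ n = true} ∈ X' ∪ {s : Set ℕ | s.Finite}}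
  have hmem : ∀ x, doubleCode (f x) ∈ Z := fun x => Or.inl (Or.inl ⟨x, rfl⟩)
  refine ⟨Z, ⟨X', hX', rfl⟩, fun x => ⟨doubleCode (f x), hmem x⟩, ?_, ?_⟩
  · exact IsEmbedding.of_comp (by
      exact (isClosedEmbedding_doubleCode.continuous.comp hf.continuous).subtype_mk _)
      continuous_subtype_val (isClosedEmbedding_doubleCode.isEmbedding.comp hf)
  -- The only codes in `Z` come from `A`: the rest of `X'` avoids codes, and codes are infinite.
  · have : Set.range (fun x => (⟨doubleCode (f x), hmem x⟩ : Z)) =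
        Subtype.val ⁻¹' Set.range doubleCode := by
      ext ⟨z, hz⟩
      constructor
      · rintro ⟨x, hx⟩
        exact ⟨f x, congrArg Subtype.val hx⟩
      · rintro ⟨y, rfl⟩
        rcases hz with (⟨x, hx⟩ | hx) | hx
        · exact ⟨x, Subtype.ext (congrArg doubleCode (hs hx))⟩
        · exact absurd ⟨y, rfl⟩ hx.2
        · exact absurd hx (infinite_doubleCode y)
    rw [this]
    exact isClosedEmbedding_doubleCode.isClosed_range.preimage continuous_subtype_val

end GammaTower

theorem mainTheorem3 :
    (∀ (m : ℕ) (Z : Fin m → Set (ℕ → Bool)),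
      (∀ i, GammaTower.IsGeneralizedTowerSet GammaTower.cardP (Z i)) →
        GammaTower.HasGamma (∀ i, Z i)) ∧
    ((∃ X : Set (Set ℕ), GammaTower.IsGeneralizedTower GammaTower.cardP X) →
      ((∀ (A : Type) [TopologicalSpace A], GammaTower.IsSetOfReals A →
          Cardinal.mk A < GammaTower.cardP → GammaTower.ProductivelyGamma A) ↔
        (∀ Z : Set (ℕ → Bool), GammaTower.IsGeneralizedTowerSet GammaTower.cardP Z →
          GammaTower.ProductivelyGamma Z))) := by
  refine ⟨fun m Z hZ => (GammaTower.smallProductGamma_pi m Z hZ).gammaSeq.hasGamma, ?_⟩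
  rintro ⟨X, hX⟩
  constructor
  · intro h Z hZ Y _ hY hYγ
    have := hY.secondCountableTopology
    have hs : GammaTower.SmallProductGamma Y := fun S hS =>
      (h S (GammaTower.isSetOfReals_subset_cantor S) hS Y hY hYγ).gammaSeq
    exact (hs.tower_prod hZ).gammaSeq.hasGamma
  · intro h A _ hA hAc Y _ hY hYγ
    have := hY.secondCountableTopology
    have := hA.secondCountableTopology
    obtain ⟨f, hf⟩ := hA.exists_isEmbedding (hAc.trans_le GammaTower.cardP_le_continuum)
    obtain ⟨Z, hZ, e, he⟩ := GammaTower.exists_towerSet_isClosedEmbedding hX hAc hf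
    exact ((h Z hZ Y hY hYγ).gammaSeq.of_isClosedEmbedding
      (he.prodMap Topology.IsClosedEmbedding.id)).hasGamma
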